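/- **Terms.** Łukasiewicz $\mu$-terms are generated by $t ::= x \mid \underline 0 \mid \underline 1 \mid q\,t \mid t\sqcup t \mid t\sqcap t \mid t\oplus t \mid t\odot t \mid \mu x.t \mid \nu x.t$ with real scalars $q\in[0,1]$. A term $t(x_1,\dots,x_n)$ with free variables among $x_1,\dots,x_n$ (taken up to renaming of bound variables) denotes a monotone function $[0,1]^n\to[0,1]$: $x_i(\vec r)=r_i$; $\underline0,\underline1$ are the constants $0,1$; $(q\,t)(\vec r)=q\cdot t(\vec r)$; $\sqcup,\sqcap$ are $\max,\min$; $a\oplus b=\min(a+b,1)$; $a\odot b=\max(a+b-1,0)$; and $(\mu x_{n+1}.t')(\vec r)$, $(\nu x_{n+1}.t')(\vec r)$ are the least and greatest fixed points of $y\mapsto t'(\vec r,y)$ on $[0,1]$. **Conditioned linear expressions.** A linear expression is $e=q_1x_1+\dots+q_nx_n+q$ with real coefficients. A conditioned linear expression $C\vdash e$ is a linear expression $e$ with a finite set $C$ of inequalities $e_1<e_2$ or $e_1\le e_2$ between linear expressions; $C(\vec s)$ says that all of them hold at $\vec s\in\mathbb R^n$. A finite set $\mathcal F$ of conditioned linear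 expressions *represents* $f:[0,1]^n\to[0,1]$ if for every $\vec r\in[0,1]^n$ some $(C\vdash e)\in\mathcal F$ has $C(\vec r)$, and whenever $(C\vdash e)\in\mathcal F$ and $C(\vec r)$ then $e(\vec r)=f(\vec r)$. **Algorithm** (with exact real arithmetic and comparisons, i.e. in the Real RAM style), on input $t(x_1,\dots,x_n)$ and $\vec r$, by recursion on $t$: - For $x_i,\underline0,\underline1$ return $\{0\le x_j,\ x_j\le1\}_{1\le j\le n}\vdash x_i,\,0,\,1$ respectively. For $q\,t_1$ compute $C_1\vdash e_1$ for $t_1$ at $\vec r$ and return $C_1\vdash q\,e_1$. - For a binary connective compute $C_1\vdash e_1$ and $C_2\vdash e_2$ for the two arguments at $\vec r$. For $\oplus$ return $C_1,C_2,e_1+e_2\le1\vdash e_1+e_2$ if $e_1(\vec r)+e_2(\vec r)\le1$, and otherwise $C_1,C_2,e_1+e_2\ge1\vdash1$. For $\odot$ return $C_1,C_2,e_1+e_2\ge1\vdash e_1+e_2-1$ if $e_1(\vec r)+e_2(\vec r)\ge1$, and otherwise $C_1,C_2,e_1+e_2\le1\vdash0$. For $\sqcup$ (resp. $\sqcap$)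 return $C_1,C_2,e_1\ge e_2\vdash e_1$ if $e_1(\vec r)\ge e_2(\vec r)$, and otherwise $C_1,C_2,e_1\le e_2\vdash e_2$ (resp. the same with all these inequalities reversed). - For $\mu x_{n+1}.t'$ start with $D=\emptyset$, $d=0$ and loop. Recursively compute $C\vdash e$ for $t'$ at $(\vec r,d(\vec r))$, with $e=q_1x_1+\dots+q_{n+1}x_{n+1}+q$, and put $p=q_1x_1+\dots+q_nx_n+q$. - If $q_{n+1}\ne1$, let $f=\frac1{1-q_{n+1}}\,p$. If $C(\vec r,f(\vec r))$, return $D\cup C(\vec x,d(\vec x))\cup C(\vec x,f(\vec x))\vdash f$. Otherwise choose an inequality of $C$ that is false at $(\vec r,f(\vec r))$, and let $N$ be the negation of that inequality with $f(\vec x)$ substituted for $x_{n+1}$. - If $q_{n+1}=1$ and $p(\vec r)=0$, return $D\cup C(\vec x,d(\vec x))\cup\{p\le 0,\ 0\le p\}\vdash d$. If $q_{n+1}=1$ and $p(\vec r)\ne0$, let $N$ be whichever of $p<0$, $0<p$ is true at $\vec r$. - If no result was returned, solve for $x_{n+1}$ the inequalities of $C$ that involve it, let $b_1,\dots,b_m$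 be the (strict or non-strict) upper bounds on $x_{n+1}$ so obtained, choose $j$ with $b_j(\vec r)\le b_i(\vec r)$ for all $i$, and repeat the loop with $D\cup C(\vec x,d(\vec x))\cup\{N\}\cup\{b_j\le b_i\mid1\le i\le m\}$ for $D$ and $e(\vec x,b_j(\vec x))$ for $d$. - For $\nu x_{n+1}.t'$ proceed dually: start with $d=1$; use the lower bounds $a_1,\dots,a_l$ on $x_{n+1}$, a $j$ with $a_j(\vec r)\ge a_i(\vec r)$ for all $i$, the constraints $a_j\ge a_i$, and the new approximation $e(\vec x,a_j(\vec x))$. **Theorem.** Let $t(x_1,\dots,x_n)$ be any Łukasiewicz $\mu$-term. For every $\vec r\in[0,1]^n$, however the choices are made, the algorithm never gets stuck, terminates, and returns a conditioned linear expression $C\vdash e$ such that - (P1) $C(\vec r)$ is true; - (P2) for all $\vec s\in\mathbb R^n$, if $C(\vec s)$ then $\vec s\in[0,1]^n$ and $e(\vec s)=t(\vec s)$. Moreover, the set of all conditioned linear expressions that the algorithm can return on $t$, over all inputs $\vec r\in[0,1]^n$ and all choices, is finite and represents the function $t:[0,1]^n\to[0,1]$. The same holds for the set $\{C_{\vec r}\vdash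 e_{\vec r}\mid\vec r\in[0,1]^n\}$ whenever $C_{\vec r}\vdash e_{\vec r}$ is, for each $\vec r$, one of the possible results at $\vec r$. -/

import Mathlib

namespace LukMu

/-! ### Terms and their values -/

/-- The four binary connectives: weak disjunction and conjunction (max, min), strong disjunction
and conjunction (truncated sum `oplus`, its dual `odot`). -/
inductive BinOp where
  | sup | inf | oplus | odot

/-- The two fixed-point binders: `mu` (least) and `nu` (greatest). -/
inductive FixKind where
  | mu | nu

/-- Lukasiewicz mu-terms `t(x_1, ..., x_n)`, i.e. with free variables among `x_1, ..., x_n`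
(up to renaming of bound variables). A binder binds the last variable `x_{n+1}` of its body. -/
inductive MuTerm : ℕ → Type where
  | var {n : ℕ} (i : Fin n) : MuTerm n
  | zero {n : ℕ} : MuTerm n
  | one {n : ℕ} : MuTerm n
  | scale {n : ℕ} (q : unitInterval) (t : MuTerm n) : MuTerm n
  | bin {n : ℕ} (op : BinOp) (t₁ t₂ : MuTerm n) : MuTerm n
  | fix {n : ℕ} (κ : FixKind) (t : MuTerm (n + 1)) : MuTerm n

/-- The interpretation of the binary connectives on `[0,1]`. -/
noncomputable def BinOp.eval : BinOp → unitInterval → unitInterval → unitInterval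
  | .sup, a, b => max a b
  | .inf, a, b => min a b
  | .oplus, a, b => ⟨min ((a : ℝ) + b) 1, le_min (add_nonneg a.2.1 b.2.1) zero_le_one,
      min_le_right _ _⟩
  | .odot, a, b => ⟨max ((a : ℝ) + b - 1) 0, le_max_right _ _,
      max_le (by linarith [a.2.2, b.2.2]) zero_le_one⟩

theorem BinOp.eval_mono (op : BinOp) {a a' b b' : unitInterval} (ha : a ≤ a') (hb : b ≤ b') :
    op.eval a b ≤ op.eval a' b' := by
  have ha' : (a : ℝ) ≤ a' := ha
  have hb' : (b : ℝ) ≤ b' := hb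
  cases op with
  | sup => exact max_le_max ha hb
  | inf => exact min_le_min ha hb
  | oplus => exact Subtype.mk_le_mk.2 (min_le_min (add_le_add ha' hb') le_rfl)
  | odot => exact Subtype.mk_le_mk.2 (max_le_max (by linarith) le_rfl)

theorem snoc_mono {n : ℕ} {r r' : Fin n → unitInterval} {y y' : unitInterval}
    (hr : r ≤ r') (hy : y ≤ y') :
    (Fin.snoc r y : Fin (n + 1) → unitInterval) ≤ Fin.snoc r' y' := by
  intro i
  refine Fin.lastCases ?_ (fun j => ?_) i
  · simpa using hy
  · simpa using hr j

/-- Least or greatest fixed point of a monotone function (Knaster-Tarski). -/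
noncomputable def FixKind.fixpoint (κ : FixKind) :
    (unitInterval →o unitInterval) →o unitInterval :=
  match κ with
  | .mu => OrderHom.lfp
  | .nu => OrderHom.gfp

/-- The value `t(r)` of a mu-term, as a monotone function `[0,1]^n → [0,1]`. -/
noncomputable def MuTerm.eval : {n : ℕ} → MuTerm n → ((Fin n → unitInterval) →o unitInterval)
  | _, .var i => ⟨fun r => r i, fun _ _ h => h i⟩
  | _, .zero => ⟨fun _ => 0, fun _ _ _ => le_rfl⟩
  | _, .one => ⟨fun _ => 1, fun _ _ _ => le_rfl⟩
  | _, .scale q t => ⟨fun r => q * t.eval r, fun _ _ h => Subtype.coe_le_coe.1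
      (mul_le_mul_of_nonneg_left (Subtype.coe_le_coe.2 (t.eval.monotone h)) q.2.1)⟩
  | _, .bin op t₁ t₂ => ⟨fun r => op.eval (t₁.eval r) (t₂.eval r),
      fun _ _ h => op.eval_mono (t₁.eval.monotone h) (t₂.eval.monotone h)⟩
  | _, .fix κ t => ⟨fun r => κ.fixpoint
        ⟨fun y => t.eval (Fin.snoc r y), fun _ _ h => t.eval.monotone (snoc_mono le_rfl h)⟩,
      fun _ _ h => κ.fixpoint.monotone fun _ => t.eval.monotone (snoc_mono h le_rfl)⟩

/-! ### Linear expressions and conditioned linear expressions -/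

/-- A linear expression `q_1 x_1 + ... + q_n x_n + q`. -/
structure LinExpr (n : ℕ) where
  coeff : Fin n → ℝ
  const : ℝ

namespace LinExpr

/-- The value of a linear expression at a real vector. -/
def eval {n : ℕ} (e : LinExpr n) (r : Fin n → ℝ) : ℝ := ∑ i, e.coeff i * r i + e.const

/-- The constant expression `c`. -/
def ofConst {n : ℕ} (c : ℝ) : LinExpr n := ⟨fun _ => 0, c⟩

/-- The expression `x_i`. -/
def ofVar {n : ℕ} (i : Fin n) : LinExpr n := ⟨Pi.single i 1, 0⟩

/-- Sum of two expressions. -/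
def add {n : ℕ} (a b : LinExpr n) : LinExpr n := ⟨a.coeff + b.coeff, a.const + b.const⟩

/-- Scalar multiple of an expression. -/
def smul {n : ℕ} (c : ℝ) (a : LinExpr n) : LinExpr n := ⟨c • a.coeff, c * a.const⟩

/-- The coefficient `q_{n+1}` of the last variable. -/
def lastCoeff {n : ℕ} (e : LinExpr (n + 1)) : ℝ := e.coeff (Fin.last n)

/-- The part `q_1 x_1 + ... + q_n x_n + q` without the last variable. -/
def rest {n : ℕ} (e : LinExpr (n + 1)) : LinExpr n := ⟨fun i => e.coeff i.castSucc, e.const⟩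

/-- The substitution `e(x_1, ..., x_n, g(x_1, ..., x_n))`. -/
def substLast {n : ℕ} (e : LinExpr (n + 1)) (g : LinExpr n) : LinExpr n :=
  e.rest.add (g.smul e.lastCoeff)

/-- `(1 / (1 - q_{n+1})) (q_1 x_1 + ... + q_n x_n + q)`, used only for `q_{n+1} ≠ 1`: the solution
of `x_{n+1} = e(x_1, ..., x_{n+1})`. -/
noncomputable def solve {n : ℕ} (e : LinExpr (n + 1)) : LinExpr n :=
  e.rest.smul (1 / (1 - e.lastCoeff))

end LinExpr

/-- Strict and non-strict inequalities between linear expressions. -/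
inductive Ineq (n : ℕ) where
  | lt (a b : LinExpr n) : Ineq n
  | le (a b : LinExpr n) : Ineq n

noncomputable instance instDecidableEqLinExpr {n : ℕ} : DecidableEq (LinExpr n) :=
  Classical.decEq _

noncomputable instance instDecidableEqIneq {n : ℕ} : DecidableEq (Ineq n) := Classical.decEq _

namespace Ineq

/-- Truth of an inequality at a real vector. -/
def Holds {n : ℕ} : Ineq n → (Fin n → ℝ) → Prop
  | .lt a b, r => a.eval r < b.eval r
  | .le a b, r => a.eval r ≤ b.eval r

/-- The negation of an inequality, again an inequality. -/
def neg {n : ℕ} : Ineq n → Ineq n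
  | .lt a b => .le b a
  | .le a b => .lt b a

/-- Left-hand side. -/
def lhs {n : ℕ} : Ineq n → LinExpr n
  | .lt a _ => a
  | .le a _ => a

/-- Right-hand side. -/
def rhs {n : ℕ} : Ineq n → LinExpr n
  | .lt _ b => b
  | .le _ b => b

/-- Substitution of `g(x_1, ..., x_n)` for the last variable. -/
def substLast {n : ℕ} : Ineq (n + 1) → LinExpr n → Ineq n
  | .lt a b, g => .lt (a.substLast g) (b.substLast g)
  | .le a b, g => .le (a.substLast g) (b.substLast g)

/-- The coefficient of `x_{n+1}` when everything is moved to the left. The inequality is an upper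
bound on `x_{n+1}` if this is positive, a lower bound if it is negative, and does not involve
`x_{n+1}` if it is zero. -/
def slope {n : ℕ} (i : Ineq (n + 1)) : ℝ := i.lhs.lastCoeff - i.rhs.lastCoeff

/-- For nonzero slope: the expression in `x_1, ..., x_n` which bounds `x_{n+1}` once the inequality
is solved for `x_{n+1}`. -/
noncomputable def bound {n : ℕ} (i : Ineq (n + 1)) : LinExpr n :=
  (i.rhs.rest.add (i.lhs.rest.smul (-1))).smul (1 / i.slope)

end Ineq

/-- A finite set of inequalities, read as a conjunction. -/
abbrev Cond (n : ℕ) : Type := Finset (Ineq n)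

namespace Cond

/-- Truth of a finite set of inequalities at a real vector. -/
def Holds {n : ℕ} (C : Cond n) (r : Fin n → ℝ) : Prop := ∀ i ∈ C, i.Holds r

/-- `C(x_1, ..., x_n, g(x_1, ..., x_n))`. -/
noncomputable def substLast {n : ℕ} (C : Cond (n + 1)) (g : LinExpr n) : Cond n :=
  C.image fun i => i.substLast g

/-- The upper bounds `b_1, ..., b_m` (strict or not) that `C` places on `x_{n+1}`. -/
noncomputable def upperTerms {n : ℕ} (C : Cond (n + 1)) : Finset (LinExpr n) :=
  (C.filter fun i => 0 < i.slope).image Ineq.bound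

/-- The lower bounds `a_1, ..., a_l` (strict or not) that `C` places on `x_{n+1}`. -/
noncomputable def lowerTerms {n : ℕ} (C : Cond (n + 1)) : Finset (LinExpr n) :=
  (C.filter fun i => i.slope < 0).image Ineq.bound

/-- The range constraints `0 ≤ x_i` and `x_i ≤ 1` for `1 ≤ i ≤ n`. -/
noncomputable def unitCube (n : ℕ) : Cond n :=
  (Finset.univ.image fun i : Fin n => Ineq.le (LinExpr.ofConst 0) (LinExpr.ofVar i)) ∪
    (Finset.univ.image fun i : Fin n => Ineq.le (LinExpr.ofVar i) (LinExpr.ofConst 1))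

end Cond

/-- A conditioned linear expression `C ⊢ e`. -/
structure CLE (n : ℕ) where
  cond : Cond n
  expr : LinExpr n

/-- A system (finite set) of conditioned linear expressions represents a function
`f : [0,1]^n → [0,1]`. -/
structure Represents {n : ℕ} (F : Set (CLE n)) (f : (Fin n → unitInterval) → unitInterval) :
    Prop where
  finite : F.Finite
  covers : ∀ r : Fin n → unitInterval, ∃ A ∈ F, A.cond.Holds fun i => (r i : ℝ)
  agrees : ∀ r : Fin n → unitInterval, ∀ A ∈ F, A.cond.Holds (fun i => (r i : ℝ)) →
    A.expr.eval (fun i => (r i : ℝ)) = f r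

/-- Property (P1): the condition is true at the input vector. -/
def CLE.P1 {n : ℕ} (A : CLE n) (r : Fin n → unitInterval) : Prop :=
  A.cond.Holds fun i => (r i : ℝ)

/-- Property (P2): any real vector satisfying the condition lies in `[0,1]^n`, and there the
expression has the value of the term. -/
def CLE.P2 {n : ℕ} (A : CLE n) (t : MuTerm n) : Prop :=
  ∀ s : Fin n → ℝ, A.cond.Holds s →
    ∃ h : ∀ i, s i ∈ unitInterval, A.expr.eval s = t.eval fun i => ⟨s i, h i⟩

/-! ### The algorithm

The algorithm is given as an abstract machine over exact reals: a state holds finitely many real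
numbers (grouped into vectors, linear expressions and conditions) and finite syntax, and a
transition carries out finitely many arithmetic operations and comparisons on them. A recursive
call pushes a frame on a stack. Where the algorithm says "choose", the transition relation allows
every admissible choice. -/

/-- Result for a binary connective at `r` from the results for its two arguments. -/
noncomputable def BinOp.combine {n : ℕ} (op : BinOp) (r : Fin n → ℝ) (A B : CLE n) : CLE n :=
  let C : Cond n := A.cond ∪ B.cond
  let s : LinExpr n := A.expr.add B.expr
  let one : LinExpr n := LinExpr.ofConst 1
  match op with
  | .sup =>
      if B.expr.eval r ≤ A.expr.eval r then ⟨C ∪ {.le B.expr A.expr}, A.expr⟩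
      else ⟨C ∪ {.le A.expr B.expr}, B.expr⟩
  | .inf =>
      if A.expr.eval r ≤ B.expr.eval r then ⟨C ∪ {.le A.expr B.expr}, A.expr⟩
      else ⟨C ∪ {.le B.expr A.expr}, B.expr⟩
  | .oplus =>
      if s.eval r ≤ 1 then ⟨C ∪ {.le s one}, s⟩
      else ⟨C ∪ {.le one s}, one⟩
  | .odot =>
      if 1 ≤ s.eval r then ⟨C ∪ {.le one s}, s.add (LinExpr.ofConst (-1))⟩
      else ⟨C ∪ {.le s one}, LinExpr.ofConst 0⟩

/-- The initial approximation: `0` for least and `1` for greatest fixed points. -/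
def FixKind.start {n : ℕ} : FixKind → LinExpr n
  | .mu => LinExpr.ofConst 0
  | .nu => LinExpr.ofConst 1

/-- The bounds on `x_{n+1}` that guide the next approximation: upper bounds for `mu`, lower bounds
for `nu`. -/
noncomputable def FixKind.terms {n : ℕ} : FixKind → Cond (n + 1) → Finset (LinExpr n)
  | .mu, C => C.upperTerms
  | .nu, C => C.lowerTerms

/-- The inequality saying that `b` is at least as tight a bound as `b'`: `b ≤ b'` for the upper
bounds used for `mu`, `b' ≤ b` for the lower bounds used for `nu`. -/
def FixKind.tighter {n : ℕ} : FixKind → LinExpr n → LinExpr n → Ineq n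
  | .mu, b, b' => .le b b'
  | .nu, b, b' => .le b' b

/-- `b` is an infimum term (for `mu`; a supremum term for `nu`) of `C` at `r`. -/
def FixKind.IsTightest {n : ℕ} (κ : FixKind) (C : Cond (n + 1)) (r : Fin n → ℝ)
    (b : LinExpr n) : Prop :=
  b ∈ κ.terms C ∧ ∀ b' ∈ κ.terms C, (κ.tighter b b').Holds r

/-- The constraints recording that `b` is the infimum (supremum) term of `C`. -/
noncomputable def FixKind.tightestCond {n : ℕ} (κ : FixKind) (C : Cond (n + 1)) (b : LinExpr n) :
    Cond n :=
  (κ.terms C).image fun b' => κ.tighter b b'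

/-- The possible choices of the inequality `N`, given the result `A` of the recursive call at
`(r, d(r))`, when the loop is not exited. -/
inductive Obstruction {n : ℕ} (A : CLE (n + 1)) (r : Fin n → ℝ) : Ineq n → Prop where
  | violated (i : Ineq (n + 1)) (hq : A.expr.lastCoeff ≠ 1) (hi : i ∈ A.cond)
      (hN : ¬ i.Holds (Fin.snoc r (A.expr.solve.eval r) : Fin (n + 1) → ℝ)) :
      Obstruction A r (i.substLast A.expr.solve).neg
  | negative (hq : A.expr.lastCoeff = 1) (hN : A.expr.rest.eval r < 0) :
      Obstruction A r (.lt A.expr.rest (LinExpr.ofConst 0))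
  | positive (hq : A.expr.lastCoeff = 1) (hN : 0 < A.expr.rest.eval r) :
      Obstruction A r (.lt (LinExpr.ofConst 0) A.expr.rest)

/-- Recursion stacks, for a machine whose top-level call has `N` variables and whose pending
recursive call has `n` variables. -/
inductive Stack (N : ℕ) : ℕ → Type where
  | halt : Stack N N
  | scale {n : ℕ} (q : unitInterval) (k : Stack N n) : Stack N n
  | binLeft {n : ℕ} (op : BinOp) (t₂ : MuTerm n) (r : Fin n → ℝ) (k : Stack N n) : Stack N n
  | binRight {n : ℕ} (op : BinOp) (A : CLE n) (r : Fin n → ℝ) (k : Stack N n) : Stack N n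
  | loop {n : ℕ} (κ : FixKind) (t : MuTerm (n + 1)) (r : Fin n → ℝ) (D : Cond n) (d : LinExpr n)
      (k : Stack N n) : Stack N (n + 1)

/-- Machine states: `call` starts the computation for a term at a vector, `ret` returns a result to
the stack, `loop` is the entry of the loop with constraints `D` and approximation `d`, and `done` is
the final state with its output. -/
inductive State (N : ℕ) : Type where
  | call {n : ℕ} (t : MuTerm n) (r : Fin n → ℝ) (k : Stack N n) : State N
  | ret {n : ℕ} (A : CLE n) (k : Stack N n) : State N
  | loop {n : ℕ} (κ : FixKind) (t : MuTerm (n + 1)) (r : Fin n → ℝ) (D : Cond n) (d : LinExpr n)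
      (k : Stack N n) : State N
  | done (A : CLE N) : State N

/-- One step of the algorithm. -/
inductive Step {N : ℕ} : State N → State N → Prop where
  | var {n : ℕ} (i : Fin n) (r : Fin n → ℝ) (k : Stack N n) :
      Step (.call (.var i) r k) (.ret ⟨Cond.unitCube n, LinExpr.ofVar i⟩ k)
  | zero {n : ℕ} (r : Fin n → ℝ) (k : Stack N n) :
      Step (.call .zero r k) (.ret ⟨Cond.unitCube n, LinExpr.ofConst 0⟩ k)
  | one {n : ℕ} (r : Fin n → ℝ) (k : Stack N n) :
      Step (.call .one r k) (.ret ⟨Cond.unitCube n, LinExpr.ofConst 1⟩ k)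
  | scaleCall {n : ℕ} (q : unitInterval) (t : MuTerm n) (r : Fin n → ℝ) (k : Stack N n) :
      Step (.call (.scale q t) r k) (.call t r (.scale q k))
  | scaleRet {n : ℕ} (q : unitInterval) (A : CLE n) (k : Stack N n) :
      Step (.ret A (.scale q k)) (.ret ⟨A.cond, A.expr.smul q⟩ k)
  | binCall {n : ℕ} (op : BinOp) (t₁ t₂ : MuTerm n) (r : Fin n → ℝ) (k : Stack N n) :
      Step (.call (.bin op t₁ t₂) r k) (.call t₁ r (.binLeft op t₂ r k))
  | binMid {n : ℕ} (op : BinOp) (t₂ : MuTerm n) (r : Fin n → ℝ) (A : CLE n) (k : Stack N n) :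
      Step (.ret A (.binLeft op t₂ r k)) (.call t₂ r (.binRight op A r k))
  | binRet {n : ℕ} (op : BinOp) (A B : CLE n) (r : Fin n → ℝ) (k : Stack N n) :
      Step (.ret B (.binRight op A r k)) (.ret (op.combine r A B) k)
  | fixCall {n : ℕ} (κ : FixKind) (t : MuTerm (n + 1)) (r : Fin n → ℝ) (k : Stack N n) :
      Step (.call (.fix κ t) r k) (.loop κ t r ∅ κ.start k)
  | loopEnter {n : ℕ} (κ : FixKind) (t : MuTerm (n + 1)) (r : Fin n → ℝ) (D : Cond n)
      (d : LinExpr n) (k : Stack N n) :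
      Step (.loop κ t r D d k)
        (.call t (Fin.snoc r (d.eval r) : Fin (n + 1) → ℝ) (.loop κ t r D d k))
  | exitSolve {n : ℕ} (κ : FixKind) (t : MuTerm (n + 1)) (r : Fin n → ℝ) (D : Cond n)
      (d : LinExpr n) (k : Stack N n) (A : CLE (n + 1))
      (hq : A.expr.lastCoeff ≠ 1)
      (hC : A.cond.Holds (Fin.snoc r (A.expr.solve.eval r) : Fin (n + 1) → ℝ)) :
      Step (.ret A (.loop κ t r D d k))
        (.ret ⟨D ∪ A.cond.substLast d ∪ A.cond.substLast A.expr.solve, A.expr.solve⟩ k)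
  | exitEq {n : ℕ} (κ : FixKind) (t : MuTerm (n + 1)) (r : Fin n → ℝ) (D : Cond n)
      (d : LinExpr n) (k : Stack N n) (A : CLE (n + 1))
      (hq : A.expr.lastCoeff = 1) (h0 : A.expr.rest.eval r = 0) :
      Step (.ret A (.loop κ t r D d k))
        (.ret ⟨D ∪ A.cond.substLast d ∪
          {.le A.expr.rest (LinExpr.ofConst 0), .le (LinExpr.ofConst 0) A.expr.rest}, d⟩ k)
  | next {n : ℕ} (κ : FixKind) (t : MuTerm (n + 1)) (r : Fin n → ℝ) (D : Cond n)
      (d : LinExpr n) (k : Stack N n) (A : CLE (n + 1)) (I : Ineq n) (b : LinExpr n)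
      (hI : Obstruction A r I) (hb : κ.IsTightest A.cond r b) :
      Step (.ret A (.loop κ t r D d k))
        (.loop κ t r (D ∪ A.cond.substLast d ∪ {I} ∪ κ.tightestCond A.cond b)
          (A.expr.substLast b) k)
  | finish (A : CLE N) : Step (.ret A .halt) (.done A)

/-- The initial state of the algorithm on the term `t` and the input vector `r`. -/
def initial {n : ℕ} (t : MuTerm n) (r : Fin n → unitInterval) : State n :=
  .call t (fun i => (r i : ℝ)) .halt

/-- Every run from state `s` terminates with an output: there is no infinite run, and every run that
cannot be continued has reached a final state. -/
def Terminates {N : ℕ} (s : State N) : Prop :=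
  (¬ ∃ σ : ℕ → State N, σ 0 = s ∧ ∀ i, Step (σ i) (σ (i + 1))) ∧
    ∀ s', Relation.ReflTransGen Step s s' → (¬ ∃ s'', Step s' s'') → ∃ A, s' = .done A

/-- The possible outputs `C ⊢ e` of the algorithm on the term `t` and the input vector `r`. -/
def outputs {n : ℕ} (t : MuTerm n) (r : Fin n → unitInterval) : Set (CLE n) :=
  {A | Relation.ReflTransGen Step (initial t r) (.done A)}

end LukMu

/-!
The proof is by induction on the term. The induction hypothesis (`Computes`) provides one finite set
`F` of conditioned linear expressions with (P2) that contains every result the algorithm can return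
for the term, at any input; and it says that every call returns such a result, true at the input.
The only interesting case is a fixed point, where `F` is given for the body `t` of the binder.

Consider `mu`, and fix an input `r`. The results `C ⊢ e` in `F` cut the graph of the monotone
function `g(y) = t(r, y)` into linear pieces, on the intervals `J = {y | C(r, y)}`. The loop keeps
`d` an approximation of the least fixed point `w` of `g`: `d ∈ [0,1]`, `d ≤ w` and `d ≤ g(d)`
(`IsApprox`). If the linear fixed point of the piece at `d` lies in its interval `J`, or if the piece
consists of fixed points, the result is correct, because `w` lies between `d` and that fixed point
(`eq_fixpoint_of_mem`). Otherwise `g` has no fixed point in `J`. Then all of `J` lies below `w`, and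
`g(y) > y` on `J` by the intermediate value theorem. Passing to the limit at the right end `b` of
`J`, the value `d' = e(r, b)` is again an approximation, and it is strictly greater than all points
of `J` (`IsApprox.next`). Hence no member of `F` is used twice, and the loop stops after at most `|F|`
iterations (`Computes.settles_loop`).

None of this depends on `r` beyond the truth of the collected constraints `D` at `r`. So `d`
is an approximation at every point of the cube where `D` holds (`Sound`), which gives (P2). As
each iteration chooses among finitely many items, finitely many pairs `(D, d)` arise in `|F|`
iterations (`loopStates`), which gives finiteness. The case of `nu` is the same after multiplying all
inequalities by the sign `-1` (`FixKind.sign`).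
-/

namespace LukMu

/-! ### Linear expressions and inequalities along the last coordinate -/

namespace LinExpr

variable {n : ℕ}

@[simp] theorem eval_ofConst (c : ℝ) (s : Fin n → ℝ) : (ofConst c : LinExpr n).eval s = c := by
  simp [eval, ofConst]

@[simp] theorem eval_ofVar (i : Fin n) (s : Fin n → ℝ) : (ofVar i).eval s = s i := by
  simp [eval, ofVar, Pi.single_apply]

@[simp] theorem eval_add (a b : LinExpr n) (s : Fin n → ℝ) :
    (a.add b).eval s = a.eval s + b.eval s := by
  simp only [eval, add, Pi.add_apply, add_mul, Finset.sum_add_distrib]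
  ring

@[simp] theorem eval_smul (c : ℝ) (a : LinExpr n) (s : Fin n → ℝ) :
    (a.smul c).eval s = c * a.eval s := by
  simp only [eval, smul, Pi.smul_apply, smul_eq_mul, mul_add, Finset.mul_sum, mul_assoc]

theorem eval_snoc (e : LinExpr (n + 1)) (s : Fin n → ℝ) (y : ℝ) :
    e.eval (Fin.snoc s y : Fin (n + 1) → ℝ) = e.lastCoeff * y + e.rest.eval s := by
  simp only [eval, Fin.sum_univ_castSucc, Fin.snoc_castSucc, Fin.snoc_last, rest, lastCoeff]
  ring

theorem eval_substLast (e : LinExpr (n + 1)) (g : LinExpr n) (s : Fin n → ℝ) :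
    (e.substLast g).eval s = e.eval (Fin.snoc s (g.eval s) : Fin (n + 1) → ℝ) := by
  rw [eval_snoc, substLast, eval_add, eval_smul]
  ring

theorem eq_eval_solve_iff {e : LinExpr (n + 1)} (hq : e.lastCoeff ≠ 1) (s : Fin n → ℝ) (y : ℝ) :
    e.eval (Fin.snoc s y : Fin (n + 1) → ℝ) = y ↔ y = e.solve.eval s := by
  have h : 1 - e.lastCoeff ≠ 0 := sub_ne_zero.2 hq.symm
  rw [eval_snoc, solve, eval_smul, one_div, eq_inv_mul_iff_mul_eq₀ h]
  constructor <;> intro hy <;> linarith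

end LinExpr

namespace Ineq

variable {n : ℕ}

theorem holds_neg (i : Ineq n) (s : Fin n → ℝ) : i.neg.Holds s ↔ ¬ i.Holds s := by
  cases i <;> simp [neg, Holds]

theorem holds_substLast (i : Ineq (n + 1)) (g : LinExpr n) (s : Fin n → ℝ) :
    (i.substLast g).Holds s ↔ i.Holds (Fin.snoc s (g.eval s) : Fin (n + 1) → ℝ) := by
  cases i <;> simp [substLast, Holds, LinExpr.eval_substLast]

theorem ordConnected_setOf_holds (i : Ineq (n + 1)) (s : Fin n → ℝ) :
    {y : ℝ | i.Holds (Fin.snoc s y : Fin (n + 1) → ℝ)}.OrdConnected := by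
  refine ⟨fun x hx z hz y hy => ?_⟩
  cases i with
  | lt a b =>
    simp only [Set.mem_ofPred_eq, Holds, LinExpr.eval_snoc] at *
    rcases le_total a.lastCoeff b.lastCoeff with h | h
    · nlinarith [hy.1]
    · nlinarith [hy.2]
  | le a b =>
    simp only [Set.mem_ofPred_eq, Holds, LinExpr.eval_snoc] at *
    rcases le_total a.lastCoeff b.lastCoeff with h | h
    · nlinarith [hy.1]
    · nlinarith [hy.2]

theorem slope_mul_bound {i : Ineq (n + 1)} (h : i.slope ≠ 0) (s : Fin n → ℝ) :
    i.slope * i.bound.eval s = i.rhs.rest.eval s - i.lhs.rest.eval s := by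
  rw [bound, LinExpr.eval_smul, LinExpr.eval_add, LinExpr.eval_smul]
  field_simp
  ring

theorem slope_mul_le {i : Ineq (n + 1)} {s : Fin n → ℝ} {y : ℝ}
    (h : i.Holds (Fin.snoc s y : Fin (n + 1) → ℝ)) :
    i.slope * y ≤ i.rhs.rest.eval s - i.lhs.rest.eval s := by
  cases i <;> simp only [Holds, LinExpr.eval_snoc, slope, lhs, rhs] at * <;> linarith

theorem holds_of_slope_mul_lt {i : Ineq (n + 1)} {s : Fin n → ℝ} {y : ℝ}
    (h : i.slope * y < i.rhs.rest.eval s - i.lhs.rest.eval s) :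
    i.Holds (Fin.snoc s y : Fin (n + 1) → ℝ) := by
  cases i <;> simp only [Holds, LinExpr.eval_snoc, slope, lhs, rhs] at * <;> linarith

theorem holds_of_slope_mul_le {i : Ineq (n + 1)} {s : Fin n → ℝ} {y z : ℝ}
    (hy : i.Holds (Fin.snoc s y : Fin (n + 1) → ℝ)) (h : i.slope * z ≤ i.slope * y) :
    i.Holds (Fin.snoc s z : Fin (n + 1) → ℝ) := by
  cases i <;> simp only [Holds, LinExpr.eval_snoc, slope, lhs, rhs] at * <;> linarith

end Ineq

namespace Cond

variable {n : ℕ}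

theorem holds_union {C D : Cond n} {s : Fin n → ℝ} :
    (C ∪ D).Holds s ↔ C.Holds s ∧ D.Holds s :=
  Finset.forall_mem_union

theorem holds_singleton {i : Ineq n} {s : Fin n → ℝ} : Cond.Holds {i} s ↔ i.Holds s := by
  simp [Holds]

theorem holds_substLast {C : Cond (n + 1)} {g : LinExpr n} {s : Fin n → ℝ} :
    (C.substLast g).Holds s ↔ C.Holds (Fin.snoc s (g.eval s) : Fin (n + 1) → ℝ) := by
  simp [Holds, substLast, Ineq.holds_substLast]

theorem holds_unitCube {s : Fin n → ℝ} : (unitCube n).Holds s ↔ ∀ i, s i ∈ unitInterval := by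
  simp only [Holds, unitCube, Finset.forall_mem_union, Finset.forall_mem_image, Finset.mem_univ,
    true_imp_iff, Ineq.Holds, LinExpr.eval_ofConst, LinExpr.eval_ofVar, Set.mem_Icc, forall_and]

/-- The set of last coordinates allowed by `C` over the point `s`. -/
def fiber (C : Cond (n + 1)) (s : Fin n → ℝ) : Set ℝ :=
  {y | C.Holds (Fin.snoc s y : Fin (n + 1) → ℝ)}

theorem ordConnected_fiber (C : Cond (n + 1)) (s : Fin n → ℝ) : (C.fiber s).OrdConnected :=
  ⟨fun _ hx _ hz _ hy i hi =>
    (i.ordConnected_setOf_holds s).out (hx i hi) (hz i hi) hy⟩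

end Cond

/-! ### Least and greatest fixed points treated alike -/

namespace FixKind

variable {n : ℕ}

/-- The sign `1` for `mu` and `-1` for `nu`. Multiplying by it turns every statement about greatest
fixed points and lower bounds into one about least fixed points and upper bounds. -/
def sign : FixKind → ℝ
  | .mu => 1
  | .nu => -1

theorem sign_mul_self (κ : FixKind) : κ.sign * κ.sign = 1 := by
  cases κ <;> norm_num [sign]

theorem sign_le_of_monotone (κ : FixKind) {g : unitInterval → unitInterval} (hg : Monotone g)
    {x y : unitInterval} (h : κ.sign * x ≤ κ.sign * y) : κ.sign * g x ≤ κ.sign * g y := by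
  cases κ with
  | mu =>
    simp only [sign, one_mul] at *
    exact hg h
  | nu =>
    simp only [sign, neg_mul, one_mul, neg_le_neg_iff] at *
    exact hg h

theorem map_fixpoint (κ : FixKind) (g : unitInterval →o unitInterval) :
    g (κ.fixpoint g) = κ.fixpoint g := by
  cases κ
  · exact OrderHom.map_lfp g
  · exact OrderHom.map_gfp g

theorem sign_fixpoint_le (κ : FixKind) (g : unitInterval →o unitInterval) {y : unitInterval}
    (hy : g y = y) : κ.sign * κ.fixpoint g ≤ κ.sign * y := by
  cases κ with
  | mu =>
    simp only [sign, one_mul]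
    exact OrderHom.lfp_le g hy.le
  | nu =>
    simp only [sign, neg_mul, one_mul, neg_le_neg_iff]
    exact OrderHom.le_gfp g hy.ge

theorem eval_start_mem (κ : FixKind) (s : Fin n → ℝ) :
    (κ.start : LinExpr n).eval s ∈ unitInterval := by
  cases κ <;> simp [start]

theorem sign_start_le (κ : FixKind) (s : Fin n → ℝ) (y : unitInterval) :
    κ.sign * (κ.start : LinExpr n).eval s ≤ κ.sign * y := by
  cases κ
  · simpa [start, sign] using y.2.1
  · simpa [start, sign] using y.2.2

theorem mem_terms {κ : FixKind} {C : Cond (n + 1)} {b : LinExpr n} :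
    b ∈ κ.terms C ↔ ∃ i ∈ C, 0 < κ.sign * i.slope ∧ i.bound = b := by
  cases κ <;> simp [terms, Cond.upperTerms, Cond.lowerTerms, sign, and_assoc]

theorem holds_tighter {κ : FixKind} {b b' : LinExpr n} {s : Fin n → ℝ} :
    (κ.tighter b b').Holds s ↔ κ.sign * b.eval s ≤ κ.sign * b'.eval s := by
  cases κ <;> simp [tighter, Ineq.Holds, sign]

theorem holds_tightestCond {κ : FixKind} {C : Cond (n + 1)} {b : LinExpr n} {s : Fin n → ℝ} :
    (κ.tightestCond C b).Holds s ↔ ∀ b' ∈ κ.terms C, (κ.tighter b b').Holds s := by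
  simp [Cond.Holds, tightestCond]

theorem sign_le_bound {κ : FixKind} {C : Cond (n + 1)} {b : LinExpr n} {s : Fin n → ℝ} {y : ℝ}
    (hb : b ∈ κ.terms C) (hy : y ∈ C.fiber s) : κ.sign * y ≤ κ.sign * b.eval s := by
  obtain ⟨i, hi, hpos, rfl⟩ := mem_terms.1 hb
  have hne : i.slope ≠ 0 := fun h => by simp [h] at hpos
  have h := Ineq.slope_mul_le (hy i hi)
  rw [← Ineq.slope_mul_bound hne] at h
  refine le_of_mul_le_mul_left ?_ hpos
  calc κ.sign * i.slope * (κ.sign * y) = κ.sign * κ.sign * (i.slope * y) := by ring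
    _ ≤ κ.sign * κ.sign * (i.slope * i.bound.eval s) := by
      rw [κ.sign_mul_self]; simpa using h
    _ = _ := by ring

/-- The points between a point of the fiber and all the guiding bounds lie in the fiber. -/
theorem mem_fiber_of_lt_terms {κ : FixKind} {C : Cond (n + 1)} {s : Fin n → ℝ} {x y : ℝ}
    (hx : x ∈ C.fiber s) (hxy : κ.sign * x ≤ κ.sign * y)
    (hy : ∀ b ∈ κ.terms C, κ.sign * y < κ.sign * b.eval s) : y ∈ C.fiber s := by
  intro i hi
  have hσ := κ.sign_mul_self
  rcases lt_or_ge 0 (κ.sign * i.slope) with hpos | hneg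
  · have hne : i.slope ≠ 0 := fun h => by simp [h] at hpos
    refine Ineq.holds_of_slope_mul_lt ?_
    rw [← Ineq.slope_mul_bound hne]
    have h := mul_lt_mul_of_pos_left (hy _ (mem_terms.2 ⟨i, hi, hpos, rfl⟩)) hpos
    calc i.slope * y = κ.sign * κ.sign * (i.slope * y) := by rw [hσ, one_mul]
      _ = κ.sign * i.slope * (κ.sign * y) := by ring
      _ < κ.sign * i.slope * (κ.sign * i.bound.eval s) := h
      _ = κ.sign * κ.sign * (i.slope * i.bound.eval s) := by ring
      _ = _ := by rw [hσ, one_mul]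
  · refine Ineq.holds_of_slope_mul_le (hx i hi) ?_
    have h := mul_le_mul_of_nonpos_left hxy hneg
    calc i.slope * y = κ.sign * κ.sign * (i.slope * y) := by rw [hσ, one_mul]
      _ = κ.sign * i.slope * (κ.sign * y) := by ring
      _ ≤ κ.sign * i.slope * (κ.sign * x) := h
      _ = κ.sign * κ.sign * (i.slope * x) := by ring
      _ = _ := by rw [hσ, one_mul]

/-- A condition whose fiber is nonempty and lies in `[0,1]` has a tightest bound. -/
theorem exists_isTightest (κ : FixKind) {C : Cond (n + 1)} {s : Fin n → ℝ} {x : ℝ}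
    (hx : x ∈ C.fiber s) (hC : C.fiber s ⊆ unitInterval) : ∃ b, κ.IsTightest C s b := by
  have hne : (κ.terms C).Nonempty := by
    by_contra hempty
    rw [Finset.not_nonempty_iff_eq_empty] at hempty
    -- Without a bound the fiber would contain a point at distance `2` from `x`.
    have hmem : x + 2 * κ.sign ∈ C.fiber s := by
      refine mem_fiber_of_lt_terms (κ := κ) hx ?_ (by simp [hempty])
      nlinarith [κ.sign_mul_self]
    have h₁ := hC hx
    have h₂ := hC hmem
    cases κ <;> simp only [sign, Set.mem_Icc] at * <;> linarith
  obtain ⟨b, hb, hmin⟩ := Finset.exists_min_image _ (fun b => κ.sign * b.eval s) hne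
  exact ⟨b, hb, fun b' hb' => holds_tighter.2 (hmin b' hb')⟩

end FixKind

/-! ### One iteration on the unit interval -/

section OneDim

theorem FixKind.mem_of_sign_le (κ : FixKind) {J : Set ℝ} (hJ : J.OrdConnected) {x y z : ℝ}
    (hx : x ∈ J) (hz : z ∈ J) (hxy : κ.sign * x ≤ κ.sign * y) (hyz : κ.sign * y ≤ κ.sign * z) :
    y ∈ J := by
  cases κ with
  | mu =>
    simp only [sign, one_mul] at hxy hyz
    exact hJ.out hx hz ⟨hxy, hyz⟩
  | nu =>
    simp only [sign, neg_mul, one_mul, neg_le_neg_iff] at hxy hyz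
    exact hJ.out hz hx ⟨hyz, hxy⟩

variable {κ : FixKind} {g : unitInterval →o unitInterval} {J : Set ℝ} {q p d β : ℝ}

/-- If the linear piece of `g` on `J` has a fixed point `f` in `J`, then `f` is the extremal fixed
point: the latter lies between the approximation `d` and `f`, hence in `J`, where the linear
equation has only one solution. -/
theorem eq_fixpoint_of_mem (hJ : J.OrdConnected)
    (hg : ∀ y ∈ J, ∃ h : y ∈ unitInterval, q * y + p = g ⟨y, h⟩) (hq : q ≠ 1)
    (hd : d ∈ J) (hdw : κ.sign * d ≤ κ.sign * κ.fixpoint g) {f : ℝ} (hf : f ∈ J)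
    (hfix : q * f + p = f) : f = κ.fixpoint g := by
  obtain ⟨hfI, hgf⟩ := hg f hf
  have hwf : κ.sign * κ.fixpoint g ≤ κ.sign * f :=
    κ.sign_fixpoint_le g (y := ⟨f, hfI⟩) (Subtype.ext (by rw [← hgf, hfix]))
  have hw : (κ.fixpoint g : ℝ) ∈ J := κ.mem_of_sign_le hJ hd hf hdw hwf
  obtain ⟨_, hgw⟩ := hg _ hw
  have hgw' : q * κ.fixpoint g + p = κ.fixpoint g := by
    rw [hgw]; exact congrArg Subtype.val (κ.map_fixpoint g)
  have : (q - 1) * (f - κ.fixpoint g) = 0 := by linarith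
  rcases mul_eq_zero.1 this with h | h
  · exact absurd (sub_eq_zero.1 h) hq
  · exact sub_eq_zero.1 h

/-- If the linear piece of `g` on `J` has no fixed point in `J`, then all of `J` comes before the
extremal fixed point, since the latter is not in `J`. -/
theorem sign_lt_fixpoint (hJ : J.OrdConnected)
    (hg : ∀ y ∈ J, ∃ h : y ∈ unitInterval, q * y + p = g ⟨y, h⟩)
    (hd : d ∈ J) (hdw : κ.sign * d ≤ κ.sign * κ.fixpoint g) (hno : ∀ y ∈ J, q * y + p ≠ y)
    {y : ℝ} (hy : y ∈ J) : κ.sign * y < κ.sign * κ.fixpoint g := by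
  by_contra! hle
  have hw : (κ.fixpoint g : ℝ) ∈ J := κ.mem_of_sign_le hJ hd hy hdw hle
  obtain ⟨_, hgw⟩ := hg _ hw
  exact hno _ hw (by rw [hgw]; exact congrArg Subtype.val (κ.map_fixpoint g))

/-- If the linear piece of `g` has no fixed point on `J` and `g` moves `d ∈ J` forward, then `g`
moves all of `J` strictly forward, by the intermediate value theorem. -/
theorem sign_lt_of_forall_ne (hJ : J.OrdConnected) (hd : d ∈ J)
    (hdg : κ.sign * d ≤ κ.sign * (q * d + p)) (hno : ∀ y ∈ J, q * y + p ≠ y)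
    {y : ℝ} (hy : y ∈ J) : κ.sign * y < κ.sign * (q * y + p) := by
  by_contra! hle
  have hcont : ContinuousOn (fun y => κ.sign * (q * y + p) - κ.sign * y) J := by fun_prop
  obtain ⟨z, hz, hz0⟩ := hJ.isPreconnected.intermediate_value hy hd hcont
    (show (0 : ℝ) ∈ Set.Icc _ _ from ⟨by linarith, by linarith⟩)
  refine hno z hz ?_
  have h : κ.sign * κ.sign * (q * z + p - z) = 0 := by
    linear_combination κ.sign * hz0
  rw [κ.sign_mul_self] at h
  linarith

/-- The tightest bound `β` of `J` is a limit of points of `J`. -/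
theorem mem_closure_of_sign (hd : d ∈ J) (hdβ : κ.sign * d ≤ κ.sign * β)
    (hJβ : ∀ y, κ.sign * d ≤ κ.sign * y → κ.sign * y < κ.sign * β → y ∈ J) :
    β ∈ closure J := by
  rcases eq_or_ne d β with rfl | hne
  · exact subset_closure hd
  cases κ with
  | mu =>
    simp only [FixKind.sign, one_mul] at hdβ hJβ
    refine closure_mono (s := Set.Ico d β) (fun y hy => hJβ y hy.1 hy.2) ?_
    rw [closure_Ico hne]
    exact ⟨hdβ, le_rfl⟩
  | nu =>
    simp only [FixKind.sign, neg_mul, one_mul, neg_le_neg_iff, neg_lt_neg_iff] at hdβ hJβ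
    refine closure_mono (s := Set.Ioc β d) (fun y hy => hJβ y hy.2 hy.1) ?_
    rw [closure_Ioc hne.symm]
    exact ⟨le_rfl, hdβ⟩

/-- `d` is an admissible approximation of the extremal fixed point `w` of `g`: it lies in `[0,1]`,
does not overshoot `w`, and is moved by `g` towards `w`. -/
structure IsApprox (κ : FixKind) (g : unitInterval →o unitInterval) (d : ℝ) : Prop where
  mem : d ∈ unitInterval
  le_fixpoint : κ.sign * d ≤ κ.sign * κ.fixpoint g
  le_map : κ.sign * d ≤ κ.sign * g ⟨d, mem⟩

/-- If the linear piece `q * y + p` of `g` on `J` has no fixed point in `J`, then its value at the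
tightest bound `β` of `J` is again an approximation, and lies strictly beyond `J`. Everything passes
to the limit from `J`, since `β` lies in the closure of `J`. -/
theorem IsApprox.next (hJ : J.OrdConnected)
    (hg : ∀ y ∈ J, ∃ h : y ∈ unitInterval, q * y + p = g ⟨y, h⟩)
    (hd : d ∈ J) (happ : IsApprox κ g d) (hno : ∀ y ∈ J, q * y + p ≠ y)
    (hle : ∀ y ∈ J, κ.sign * y ≤ κ.sign * β)
    (hJβ : ∀ y, κ.sign * d ≤ κ.sign * y → κ.sign * y < κ.sign * β → y ∈ J) :
    IsApprox κ g (q * β + p) ∧ ∀ y ∈ J, κ.sign * y < κ.sign * (q * β + p) := by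
  have hdg : κ.sign * d ≤ κ.sign * (q * d + p) := by
    obtain ⟨h, hgd⟩ := hg d hd
    rw [hgd]
    exact happ.le_map
  have hβ : β ∈ closure J := mem_closure_of_sign hd (hle d hd) hJβ
  have hlimit : ∀ P : Set ℝ, IsClosed P → (∀ y ∈ J, y ∈ P) → β ∈ P :=
    fun P hP hsub => hP.closure_subset_iff.2 hsub hβ
  have hmem : q * β + p ∈ unitInterval := by
    refine hlimit {y | q * y + p ∈ unitInterval}
      (isClosed_Icc.preimage (by fun_prop)) fun y hy => ?_
    obtain ⟨h, hgy⟩ := hg y hy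
    change q * y + p ∈ unitInterval
    rw [hgy]
    exact Subtype.property _
  have hfix : κ.sign * (q * β + p) ≤ κ.sign * κ.fixpoint g := by
    refine hlimit {y | κ.sign * (q * y + p) ≤ κ.sign * κ.fixpoint g}
      (isClosed_le (by fun_prop) (by fun_prop)) fun y hy => ?_
    obtain ⟨h, hgy⟩ := hg y hy
    change κ.sign * (q * y + p) ≤ κ.sign * κ.fixpoint g
    rw [hgy, ← κ.map_fixpoint g]
    exact κ.sign_le_of_monotone g.monotone
      (sign_lt_fixpoint hJ hg hd happ.le_fixpoint hno hy).le
  have hβle : κ.sign * β ≤ κ.sign * (q * β + p) := by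
    refine hlimit {y | κ.sign * y ≤ κ.sign * (q * y + p)}
      (isClosed_le (by fun_prop) (by fun_prop)) fun y hy => ?_
    exact (sign_lt_of_forall_ne hJ hd hdg hno hy).le
  refine ⟨⟨hmem, hfix, ?_⟩, fun y hy => ?_⟩
  · refine hlimit {y | κ.sign * (q * y + p) ≤ κ.sign * g ⟨q * β + p, hmem⟩}
      (isClosed_le (by fun_prop) (by fun_prop)) fun y hy => ?_
    obtain ⟨h, hgy⟩ := hg y hy
    change κ.sign * (q * y + p) ≤ _
    rw [hgy]
    exact κ.sign_le_of_monotone g.monotone ((hle y hy).trans hβle)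
  · rcases (hle y hy).lt_or_eq with hlt | heq
    · exact hlt.trans_le hβle
    · have hyβ : y = β := by
        have h : κ.sign * κ.sign * y = κ.sign * κ.sign * β := by
          linear_combination κ.sign * heq
        simpa [κ.sign_mul_self] using h
      exact hyβ ▸ sign_lt_of_forall_ne hJ hd hdg hno hy

end OneDim

/-! ### Property (P2) for the result of one piece -/

section Pieces

variable {n : ℕ}

theorem coe_snoc (r : Fin n → unitInterval) (y : unitInterval) :
    (fun i => ((Fin.snoc r y : Fin (n + 1) → unitInterval) i : ℝ)) =
      (Fin.snoc (fun i => (r i : ℝ)) (y : ℝ) : Fin (n + 1) → ℝ) := by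
  funext i
  refine Fin.lastCases ?_ (fun j => ?_) i <;> simp

theorem CLE.p2_iff {A : CLE n} {t : MuTerm n} :
    A.P2 t ↔ ∀ s, A.cond.Holds s → ∃ r : Fin n → unitInterval,
      s = (fun i => (r i : ℝ)) ∧ A.expr.eval s = t.eval r := by
  refine forall₂_congr fun s _ => ⟨fun ⟨h, he⟩ => ⟨fun i => ⟨s i, h i⟩, rfl, he⟩, ?_⟩
  rintro ⟨r, rfl, he⟩
  exact ⟨fun i => (r i).2, he⟩

/-- The monotone function `y ↦ t(r, y)` whose extremal fixed point a binder takes. -/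
noncomputable def MuTerm.slice (t : MuTerm (n + 1)) (r : Fin n → unitInterval) :
    unitInterval →o unitInterval :=
  ⟨fun y => t.eval (Fin.snoc r y), fun _ _ h => t.eval.monotone (snoc_mono le_rfl h)⟩

theorem MuTerm.eval_fix (κ : FixKind) (t : MuTerm (n + 1)) (r : Fin n → unitInterval) :
    (MuTerm.fix κ t).eval r = κ.fixpoint (t.slice r) := rfl

theorem CLE.P2.exists_coe {A : CLE (n + 1)} {t : MuTerm (n + 1)} (hA : A.P2 t) {s : Fin n → ℝ}
    {y : ℝ} (hy : y ∈ A.cond.fiber s) : ∃ r : Fin n → unitInterval, s = fun i => (r i : ℝ) := by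
  obtain ⟨h, -⟩ := hA _ hy
  exact ⟨fun i => ⟨s i, by simpa using h i.castSucc⟩, rfl⟩

/-- Over a point of the cube, the expression is a linear piece of the function `y ↦ t(r, y)`. -/
theorem CLE.P2.slice_eq {A : CLE (n + 1)} {t : MuTerm (n + 1)} (hA : A.P2 t)
    (r : Fin n → unitInterval) {y : ℝ} (hy : y ∈ A.cond.fiber fun i => (r i : ℝ)) :
    ∃ h : y ∈ unitInterval,
      A.expr.lastCoeff * y + A.expr.rest.eval (fun i => (r i : ℝ)) = t.slice r ⟨y, h⟩ := by
  obtain ⟨h, he⟩ := hA _ hy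
  have hyI : y ∈ unitInterval := by simpa using h (Fin.last n)
  refine ⟨hyI, ?_⟩
  rw [← LinExpr.eval_snoc, he]
  refine congrArg (fun v => ((t.eval v : unitInterval) : ℝ)) ?_
  funext i
  refine Fin.lastCases ?_ (fun j => ?_) i <;> ext <;> simp

/-- An obstruction excludes fixed points of the linear piece from the piece, at every point where
the chosen inequality holds. -/
theorem Obstruction.ne_of_holds {A : CLE (n + 1)} {r : Fin n → ℝ} {I : Ineq n}
    (hI : Obstruction A r I) {s : Fin n → ℝ} (hs : I.Holds s) {y : ℝ} (hy : y ∈ A.cond.fiber s) :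
    A.expr.lastCoeff * y + A.expr.rest.eval s ≠ y := by
  cases hI with
  | violated i hq hi _ =>
    intro h
    rw [← LinExpr.eval_snoc, LinExpr.eq_eval_solve_iff hq] at h
    rw [Ineq.holds_neg, Ineq.holds_substLast, ← h] at hs
    exact hs (hy i hi)
  | negative hq _ =>
    simp only [Ineq.Holds, LinExpr.eval_ofConst] at hs
    rw [hq]
    intro h
    linarith
  | positive hq _ =>
    simp only [Ineq.Holds, LinExpr.eval_ofConst] at hs
    rw [hq]
    intro h
    linarith

theorem Obstruction.holds {A : CLE (n + 1)} {r : Fin n → ℝ} {I : Ineq n}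
    (hI : Obstruction A r I) : I.Holds r := by
  cases hI with
  | violated i hq hi hN => rwa [Ineq.holds_neg, Ineq.holds_substLast]
  | negative hq hN => simpa [Ineq.Holds] using hN
  | positive hq hN => simpa [Ineq.Holds] using hN

theorem finite_setOf_obstruction (A : CLE (n + 1)) : {I | ∃ r, Obstruction A r I}.Finite := by
  refine Set.Finite.subset ((A.cond.image fun i => (i.substLast A.expr.solve).neg) ∪
    {.lt A.expr.rest (LinExpr.ofConst 0), .lt (LinExpr.ofConst 0) A.expr.rest} :
      Finset (Ineq n)).finite_toSet ?_
  rintro I ⟨r, hI⟩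
  cases hI with
  | violated i hq hi hN =>
    exact Finset.mem_union_left _ (Finset.mem_image_of_mem _ hi)
  | negative hq hN => simp
  | positive hq hN => simp

end Pieces

/-! ### The states and results of the loop -/

section Loop

variable {n : ℕ}

/-- The pairs `(D, d)` of constraints and approximation that the loop can have after `k` iterations,
if the results of the recursive calls come from `F`. The input vector is forgotten, so that there
are only finitely many. -/
def loopStates (κ : FixKind) (F : Set (CLE (n + 1))) : ℕ → Set (Cond n × LinExpr n)
  | 0 => {(∅, κ.start)}
  | k + 1 => ⋃ x ∈ loopStates κ F k, ⋃ A ∈ F, ⋃ I ∈ {I | ∃ r, Obstruction A r I},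
      (fun b => (x.1 ∪ A.cond.substLast x.2 ∪ {I} ∪ κ.tightestCond A.cond b, A.expr.substLast b)) ''
        (κ.terms A.cond : Set (LinExpr n))

/-- The result returned when the linear fixed point lies in the piece `A`. -/
noncomputable def solveResult (D : Cond n) (d : LinExpr n) (A : CLE (n + 1)) : CLE n :=
  ⟨D ∪ A.cond.substLast d ∪ A.cond.substLast A.expr.solve, A.expr.solve⟩

/-- The result returned when the piece `A` has slope one and consists of fixed points. -/
noncomputable def eqResult (D : Cond n) (d : LinExpr n) (A : CLE (n + 1)) : CLE n :=
  ⟨D ∪ A.cond.substLast d ∪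
    {.le A.expr.rest (LinExpr.ofConst 0), .le (LinExpr.ofConst 0) A.expr.rest}, d⟩

/-- The results that the loop can return within `K` iterations, if the results of the recursive
calls come from `F`. -/
def loopResults (κ : FixKind) (F : Set (CLE (n + 1))) (K : ℕ) : Set (CLE n) :=
  ⋃ k ∈ Set.Iic K, ⋃ x ∈ loopStates κ F k, ⋃ A ∈ F,
    {R | A.expr.lastCoeff ≠ 1 ∧ R = solveResult x.1 x.2 A ∨
      A.expr.lastCoeff = 1 ∧ R = eqResult x.1 x.2 A}

theorem finite_loopStates (κ : FixKind) {F : Set (CLE (n + 1))} (hF : F.Finite) (k : ℕ) :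
    (loopStates κ F k).Finite := by
  induction k with
  | zero => exact Set.finite_singleton _
  | succ k ih =>
    exact ih.biUnion fun x _ => hF.biUnion fun A _ => (finite_setOf_obstruction A).biUnion
      fun I _ => (Finset.finite_toSet _).image _

theorem finite_loopResults (κ : FixKind) {F : Set (CLE (n + 1))} (hF : F.Finite) (K : ℕ) :
    (loopResults κ F K).Finite := by
  refine (Set.finite_Iic K).biUnion fun k _ => (finite_loopStates κ hF k).biUnion
    fun x _ => hF.biUnion fun A _ => ?_
  refine Set.Finite.subset (s := {solveResult x.1 x.2 A, eqResult x.1 x.2 A}) (by simp) ?_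
  rintro R (⟨-, rfl⟩ | ⟨-, rfl⟩) <;> simp

/-- Wherever `D` holds, `d` is an approximation of the extremal fixed point. -/
def Sound (κ : FixKind) (t : MuTerm (n + 1)) (D : Cond n) (d : LinExpr n) : Prop :=
  ∀ r : Fin n → unitInterval, D.Holds (fun i => (r i : ℝ)) →
    IsApprox κ (t.slice r) (d.eval fun i => (r i : ℝ))

theorem sound_start (κ : FixKind) (t : MuTerm (n + 1)) : Sound κ t ∅ κ.start := fun _ _ =>
  ⟨κ.eval_start_mem _, κ.sign_start_le _ _, κ.sign_start_le _ _⟩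

/-- One iteration preserves soundness, and the new approximation lies strictly beyond the piece that
was used, so that this piece is never met again. -/
theorem Sound.next {κ : FixKind} {t : MuTerm (n + 1)} {D : Cond n} {d : LinExpr n}
    (hDd : Sound κ t D d) {A : CLE (n + 1)} (hA : A.P2 t) {r₀ : Fin n → ℝ} {I : Ineq n}
    (hI : Obstruction A r₀ I) {b : LinExpr n} (hb : b ∈ κ.terms A.cond)
    {r : Fin n → unitInterval}
    (hr : (D ∪ A.cond.substLast d ∪ {I} ∪ κ.tightestCond A.cond b).Holds fun i => (r i : ℝ)) :
    IsApprox κ (t.slice r) ((A.expr.substLast b).eval fun i => (r i : ℝ)) ∧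
      ∀ y ∈ A.cond.fiber fun i => (r i : ℝ),
        κ.sign * y < κ.sign * (A.expr.substLast b).eval fun i => (r i : ℝ) := by
  simp only [Cond.holds_union, Cond.holds_singleton, Cond.holds_substLast] at hr
  obtain ⟨⟨⟨hD, hC⟩, hIr⟩, htight⟩ := hr
  rw [FixKind.holds_tightestCond] at htight
  rw [LinExpr.eval_substLast, LinExpr.eval_snoc]
  refine IsApprox.next (A.cond.ordConnected_fiber _) (fun y hy => hA.slice_eq r hy) hC
    (hDd r hD) (fun y hy => hI.ne_of_holds hIr hy) (fun y hy => FixKind.sign_le_bound hb hy) ?_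
  intro y hdy hyb
  exact FixKind.mem_fiber_of_lt_terms hC hdy fun b' hb' =>
    hyb.trans_le (FixKind.holds_tighter.1 (htight b' hb'))

theorem sound_of_mem_loopStates {κ : FixKind} {t : MuTerm (n + 1)} {F : Set (CLE (n + 1))}
    (hF : ∀ A ∈ F, A.P2 t) {k : ℕ} {x : Cond n × LinExpr n} (hx : x ∈ loopStates κ F k) :
    Sound κ t x.1 x.2 := by
  induction k generalizing x with
  | zero =>
    obtain rfl : x = (∅, κ.start) := hx
    exact sound_start κ t
  | succ k ih =>
    simp only [loopStates, Set.mem_iUnion] at hx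
    obtain ⟨y, hy, A, hA, I, ⟨r₀, hI⟩, b, hb, rfl⟩ := hx
    exact fun r hr => ((ih hy).next (hF A hA) hI hb hr).1

theorem p2_solveResult {κ : FixKind} {t : MuTerm (n + 1)} {D : Cond n} {d : LinExpr n}
    (hDd : Sound κ t D d) {A : CLE (n + 1)} (hA : A.P2 t) (hq : A.expr.lastCoeff ≠ 1) :
    (solveResult D d A).P2 (.fix κ t) := by
  rw [CLE.p2_iff]
  intro s hs
  simp only [solveResult, Cond.holds_union, Cond.holds_substLast] at hs
  obtain ⟨⟨hD, hd⟩, hf⟩ := hs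
  obtain ⟨r, rfl⟩ := hA.exists_coe hd
  refine ⟨r, rfl, ?_⟩
  rw [MuTerm.eval_fix]
  refine eq_fixpoint_of_mem (A.cond.ordConnected_fiber _) (fun y hy => hA.slice_eq r hy) hq hd
    (hDd r hD).le_fixpoint hf ?_
  rw [← LinExpr.eval_snoc]
  exact (LinExpr.eq_eval_solve_iff hq _ _).2 rfl

theorem p2_eqResult {κ : FixKind} {t : MuTerm (n + 1)} {D : Cond n} {d : LinExpr n}
    (hDd : Sound κ t D d) {A : CLE (n + 1)} (hA : A.P2 t) (hq : A.expr.lastCoeff = 1) :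
    (eqResult D d A).P2 (.fix κ t) := by
  rw [CLE.p2_iff]
  intro s hs
  simp only [eqResult, Cond.holds_union, Cond.holds_substLast] at hs
  obtain ⟨⟨hD, hd⟩, h0⟩ := hs
  obtain ⟨r, rfl⟩ := hA.exists_coe hd
  refine ⟨r, rfl, ?_⟩
  simp only [Cond.Holds, Finset.forall_mem_insert, Finset.mem_singleton, forall_eq, Ineq.Holds,
    LinExpr.eval_ofConst] at h0
  obtain ⟨hI, hy⟩ := hA.slice_eq r hd
  rw [hq, one_mul, le_antisymm h0.1 h0.2, add_zero] at hy
  have hle := (hDd r hD).le_fixpoint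
  have hge := κ.sign_fixpoint_le (t.slice r) (y := ⟨_, hI⟩) (Subtype.ext hy.symm)
  have h : κ.sign * κ.sign * d.eval (fun i => (r i : ℝ)) =
      κ.sign * κ.sign * κ.fixpoint (t.slice r) := by
    linear_combination κ.sign * le_antisymm hle hge
  rwa [κ.sign_mul_self, one_mul, one_mul] at h

end Loop

/-! ### Runs of the machine -/

/-- Every run from the state terminates in a final state whose output satisfies `Q`, and no run gets
stuck before. -/
inductive Settles {N : ℕ} (Q : CLE N → Prop) : State N → Prop
  | done (A : CLE N) (h : Q A) : Settles Q (.done A)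
  | step (s : State N) (hex : ∃ s', Step s s') (h : ∀ s', Step s s' → Settles Q s') : Settles Q s

namespace Settles

variable {N : ℕ} {Q : CLE N → Prop} {s s' : State N}

theorem of_step (h : Settles Q s) (hs : Step s s') : Settles Q s' := by
  cases h with
  | done A _ => cases hs
  | step s _ h => exact h _ hs

theorem of_reflTransGen (h : Settles Q s) (hs : Relation.ReflTransGen Step s s') :
    Settles Q s' := by
  induction hs with
  | refl => exact h
  | tail _ hstep ih => exact ih.of_step hstep

theorem terminates (h : Settles Q s) : Terminates s := by
  constructor
  · rintro ⟨σ, rfl, hσ⟩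
    suffices ∀ s, Settles Q s → ∀ i, σ i ≠ s from this _ h 0 rfl
    intro s hs
    induction hs with
    | done A _ =>
      intro i hi
      have := hσ i
      rw [hi] at this
      cases this
    | step s _ _ ih =>
      rintro i rfl
      exact ih _ (hσ i) (i + 1) rfl
  · intro s' hs' hstuck
    cases h.of_reflTransGen hs' with
    | done A _ => exact ⟨A, rfl⟩
    | step _ hex _ => exact absurd hex hstuck

theorem of_output {A : CLE N} (h : Settles Q s)
    (hs : Relation.ReflTransGen Step s (.done A)) : Q A := by
  cases h.of_reflTransGen hs with
  | done _ hA => exact hA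
  | step _ hex _ =>
    obtain ⟨_, hstep⟩ := hex
    cases hstep

theorem exists_output (h : Settles Q s) : ∃ A, Relation.ReflTransGen Step s (.done A) := by
  induction h with
  | done A _ => exact ⟨A, .refl⟩
  | step s hex _ ih =>
    obtain ⟨s', hstep⟩ := hex
    obtain ⟨A, hA⟩ := ih s' hstep
    exact ⟨A, hA.head hstep⟩

end Settles

/-- The finite set `F` contains all results for `t`: its members satisfy (P2), and a call of `t`
returns to the stack a member of `F` that is true at the input. The latter is expressed in
continuation-passing style, for an arbitrary stack and goal `Q`. -/
structure Computes {n : ℕ} (t : MuTerm n) (F : Set (CLE n)) : Prop where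
  finite : F.Finite
  p2 : ∀ A ∈ F, A.P2 t
  settles : ∀ {N : ℕ} (r : Fin n → unitInterval) (k : Stack N n) (Q : CLE N → Prop),
    (∀ A ∈ F, A.P1 r → Settles Q (.ret A k)) → Settles Q (.call t (fun i => (r i : ℝ)) k)

section Computes

variable {n : ℕ}

theorem computes_var (i : Fin n) :
    Computes (.var i) {⟨Cond.unitCube n, LinExpr.ofVar i⟩} where
  finite := Set.finite_singleton _
  p2 := by
    rintro _ rfl s hs
    exact ⟨Cond.holds_unitCube.1 hs, LinExpr.eval_ofVar _ _⟩
  settles r k Q h := by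
    refine .step _ ⟨_, .var i _ k⟩ fun s' hs' => ?_
    cases hs'
    exact h _ rfl (Cond.holds_unitCube.2 fun j => (r j).2)

theorem computes_zero : Computes (n := n) .zero {⟨Cond.unitCube n, LinExpr.ofConst 0⟩} where
  finite := Set.finite_singleton _
  p2 := by
    rintro _ rfl s hs
    exact ⟨Cond.holds_unitCube.1 hs, LinExpr.eval_ofConst _ _⟩
  settles r k Q h := by
    refine .step _ ⟨_, .zero _ k⟩ fun s' hs' => ?_
    cases hs'
    exact h _ rfl (Cond.holds_unitCube.2 fun j => (r j).2)

theorem computes_one : Computes (n := n) .one {⟨Cond.unitCube n, LinExpr.ofConst 1⟩} where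
  finite := Set.finite_singleton _
  p2 := by
    rintro _ rfl s hs
    exact ⟨Cond.holds_unitCube.1 hs, LinExpr.eval_ofConst _ _⟩
  settles r k Q h := by
    refine .step _ ⟨_, .one _ k⟩ fun s' hs' => ?_
    cases hs'
    exact h _ rfl (Cond.holds_unitCube.2 fun j => (r j).2)

theorem Computes.scale {t : MuTerm n} {F : Set (CLE n)} (hF : Computes t F) (q : unitInterval) :
    Computes (.scale q t) ((fun A : CLE n => ⟨A.cond, A.expr.smul q⟩) '' F) where
  finite := hF.finite.image _
  p2 := by
    rintro _ ⟨A, hA, rfl⟩ s hs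
    obtain ⟨h, he⟩ := hF.p2 A hA s hs
    exact ⟨h, (LinExpr.eval_smul _ _ _).trans (congrArg ((q : ℝ) * ·) he)⟩
  settles r k Q h := by
    refine .step _ ⟨_, .scaleCall q t _ k⟩ fun s' hs' => ?_
    cases hs'
    refine hF.settles r _ Q fun A hA hP1 => ?_
    refine .step _ ⟨_, .scaleRet q A k⟩ fun s' hs' => ?_
    cases hs'
    exact h _ (Set.mem_image_of_mem _ hA) hP1

theorem p1_combine (op : BinOp) {r : Fin n → unitInterval} {A B : CLE n} (hA : A.P1 r)
    (hB : B.P1 r) : (op.combine (fun i => (r i : ℝ)) A B).P1 r := by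
  unfold CLE.P1 at *
  cases op <;> simp only [BinOp.combine] <;> split_ifs with h <;>
    simp only [Cond.holds_union, Cond.holds_singleton, hA, hB, Ineq.Holds, true_and,
      LinExpr.eval_ofConst] <;> linarith

theorem p2_combine (op : BinOp) (r : Fin n → ℝ) {A B : CLE n} {t₁ t₂ : MuTerm n} (hA : A.P2 t₁)
    (hB : B.P2 t₂) : (op.combine r A B).P2 (.bin op t₁ t₂) := by
  intro s hs
  have hAB : A.cond.Holds s ∧ B.cond.Holds s := by
    cases op <;> simp only [BinOp.combine] at hs <;> split_ifs at hs <;>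
      exact Cond.holds_union.1 (Cond.holds_union.1 hs).1
  obtain ⟨h, he₁⟩ := hA s hAB.1
  obtain ⟨_, he₂⟩ := hB s hAB.2
  refine ⟨h, ?_⟩
  change _ = ((op.eval (t₁.eval fun i => ⟨s i, h i⟩) (t₂.eval fun i => ⟨s i, h i⟩) :
    unitInterval) : ℝ)
  generalize t₁.eval (fun i => ⟨s i, h i⟩) = a at he₁ ⊢
  generalize t₂.eval (fun i => ⟨s i, h i⟩) = b at he₂ ⊢
  cases op <;> simp only [BinOp.combine] at hs ⊢ <;> split_ifs at hs ⊢ <;>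
    simp only [Cond.holds_union, Cond.holds_singleton, Ineq.Holds, LinExpr.eval_add,
      LinExpr.eval_ofConst, he₁, he₂] at hs ⊢
  · exact congrArg Subtype.val (max_eq_left (α := unitInterval) hs.2).symm
  · exact congrArg Subtype.val (max_eq_right (α := unitInterval) hs.2).symm
  · exact congrArg Subtype.val (min_eq_left (α := unitInterval) hs.2).symm
  · exact congrArg Subtype.val (min_eq_right (α := unitInterval) hs.2).symm
  · exact (min_eq_left hs.2).symm
  · exact (min_eq_right hs.2).symm
  · exact (max_eq_left (sub_nonneg.2 hs.2)).symm
  · exact (max_eq_right (sub_nonpos.2 hs.2)).symm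

/-- The results for a binary connective: the choice between the two cases of `combine` depends on
the input vector, but takes only finitely many values. -/
theorem finite_combine (op : BinOp) (A B : CLE n) :
    {R | ∃ r, R = op.combine r A B}.Finite := by
  have hite (p : (Fin n → ℝ) → Prop) [DecidablePred p] (R₁ R₂ : CLE n) :
      {R | ∃ r, R = if p r then R₁ else R₂}.Finite := by
    refine Set.Finite.subset (Set.toFinite {R₁, R₂}) ?_
    rintro R ⟨r, rfl⟩
    split_ifs <;> simp
  cases op <;> exact hite _ _ _

theorem Computes.bin {t₁ t₂ : MuTerm n} {F₁ F₂ : Set (CLE n)} (h₁ : Computes t₁ F₁)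
    (h₂ : Computes t₂ F₂) (op : BinOp) :
    Computes (.bin op t₁ t₂) (⋃ A ∈ F₁, ⋃ B ∈ F₂, {R | ∃ r, R = op.combine r A B}) where
  finite := h₁.finite.biUnion fun A _ => h₂.finite.biUnion fun B _ => finite_combine op A B
  p2 := by
    simp only [Set.mem_iUnion]
    rintro _ ⟨A, hA, B, hB, r, rfl⟩
    exact p2_combine op r (h₁.p2 A hA) (h₂.p2 B hB)
  settles r k Q h := by
    refine .step _ ⟨_, .binCall op t₁ t₂ _ k⟩ fun s' hs' => ?_
    cases hs'
    refine h₁.settles r _ Q fun A hA hP1A => ?_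
    refine .step _ ⟨_, .binMid op t₂ _ A k⟩ fun s' hs' => ?_
    cases hs'
    refine h₂.settles r _ Q fun B hB hP1B => ?_
    refine .step _ ⟨_, .binRet op A B _ k⟩ fun s' hs' => ?_
    cases hs'
    refine h _ ?_ (p1_combine op hP1A hP1B)
    simp only [Set.mem_iUnion]
    exact ⟨A, hA, B, hB, _, rfl⟩

/-- The loop settles. The set `U` collects the pieces used so far. At the present input they all lie
strictly before the approximation `d`, so every iteration uses a new one. -/
theorem Computes.settles_loop {κ : FixKind} {t : MuTerm (n + 1)} {F : Set (CLE (n + 1))}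
    (hF : Computes t F) {N : ℕ} (r : Fin n → unitInterval) (k : Stack N n) (Q : CLE N → Prop)
    (hQ : ∀ A ∈ loopResults κ F F.ncard, A.P1 r → Settles Q (.ret A k))
    {D : Cond n} {d : LinExpr n} (U : Set (CLE (n + 1))) (hU : U ⊆ F)
    (hstate : (D, d) ∈ loopStates κ F U.ncard) (hD : D.Holds fun i => (r i : ℝ))
    (hused : ∀ A ∈ U, ∀ y ∈ A.cond.fiber fun i => (r i : ℝ),
      κ.sign * y < κ.sign * d.eval fun i => (r i : ℝ)) :
    Settles Q (.loop κ t (fun i => (r i : ℝ)) D d k) := by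
  induction hm : F.ncard - U.ncard using Nat.strong_induction_on generalizing D d U with
  | _ m ih =>
  subst hm
  have hsound : Sound κ t D d := sound_of_mem_loopStates hF.p2 hstate
  have happ := hsound r hD
  refine .step _ ⟨_, .loopEnter κ t _ D d k⟩ fun s' hs' => ?_
  cases hs'
  rw [← coe_snoc r ⟨_, happ.mem⟩]
  refine hF.settles _ _ Q fun A hA hP1 => ?_
  have hd : A.cond.Holds (Fin.snoc (fun i => (r i : ℝ)) (d.eval fun i => (r i : ℝ)) :
      Fin (n + 1) → ℝ) := by
    rw [← coe_snoc r ⟨_, happ.mem⟩]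
    exact hP1
  have hAU : A ∉ U := fun h => (hused A h _ hd).false
  have hle : U.ncard ≤ F.ncard := Set.ncard_le_ncard hU hF.finite
  have hins : insert A U ⊆ F := Set.insert_subset hA hU
  have hcard : (insert A U).ncard = U.ncard + 1 :=
    Set.ncard_insert_of_notMem hAU (hF.finite.subset hU)
  have hlt : (insert A U).ncard ≤ F.ncard := Set.ncard_le_ncard hins hF.finite
  obtain ⟨b, hb⟩ := κ.exists_isTightest (C := A.cond) hd
    fun y hy => ((hF.p2 A hA).slice_eq r hy).1
  have hresult {R : CLE n} (hR : A.expr.lastCoeff ≠ 1 ∧ R = solveResult D d A ∨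
      A.expr.lastCoeff = 1 ∧ R = eqResult D d A) : R ∈ loopResults κ F F.ncard := by
    simp only [loopResults, Set.mem_iUnion]
    exact ⟨_, hle, _, hstate, A, hA, hR⟩
  refine .step _ ?_ fun s' hs' => ?_
  · by_cases hq : A.expr.lastCoeff = 1
    · rcases lt_trichotomy (A.expr.rest.eval fun i => (r i : ℝ)) 0 with h | h | h
      · exact ⟨_, .next κ t _ D d k A _ b (.negative hq h) hb⟩
      · exact ⟨_, .exitEq κ t _ D d k A hq h⟩
      · exact ⟨_, .next κ t _ D d k A _ b (.positive hq h) hb⟩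
    · by_cases hC : A.cond.Holds (Fin.snoc (fun i => (r i : ℝ))
          (A.expr.solve.eval fun i => (r i : ℝ)) : Fin (n + 1) → ℝ)
      · exact ⟨_, .exitSolve κ t _ D d k A hq hC⟩
      · simp only [Cond.Holds, not_forall] at hC
        obtain ⟨i, hi, hN⟩ := hC
        exact ⟨_, .next κ t _ D d k A _ b (.violated i hq hi hN) hb⟩
  · cases hs' with
    | exitSolve _ _ _ _ _ _ _ hq hC =>
      refine hQ _ (hresult (.inl ⟨hq, rfl⟩)) ?_
      exact Cond.holds_union.2
        ⟨Cond.holds_union.2 ⟨hD, Cond.holds_substLast.2 hd⟩, Cond.holds_substLast.2 hC⟩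
    | exitEq _ _ _ _ _ _ _ hq h0 =>
      refine hQ _ (hresult (.inr ⟨hq, rfl⟩)) ?_
      refine Cond.holds_union.2 ⟨Cond.holds_union.2 ⟨hD, Cond.holds_substLast.2 hd⟩, ?_⟩
      simp [Cond.Holds, Ineq.Holds, h0]
    | next _ _ _ _ _ _ _ I b hI hb =>
      have hD' : (D ∪ A.cond.substLast d ∪ {I} ∪ κ.tightestCond A.cond b).Holds
          fun i => (r i : ℝ) := by
        simp only [Cond.holds_union, Cond.holds_singleton, Cond.holds_substLast,
          FixKind.holds_tightestCond]
        exact ⟨⟨⟨hD, hd⟩, hI.holds⟩, hb.2⟩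
      obtain ⟨happ', hbeyond⟩ := hsound.next (hF.p2 A hA) hI hb.1 hD'
      refine ih _ (by omega) (insert A U) hins ?_ hD' ?_ rfl
      · rw [hcard]
        simp only [loopStates, Set.mem_iUnion]
        exact ⟨_, hstate, A, hA, I, ⟨_, hI⟩, b, hb.1, rfl⟩
      · rintro B (rfl | hB) y hy
        · exact hbeyond y hy
        · -- The approximations increase, as the old one lies in the piece `A`.
          exact (hused B hB y hy).trans (hbeyond _ hd)

theorem Computes.fix {t : MuTerm (n + 1)} {F : Set (CLE (n + 1))} (hF : Computes t F)
    (κ : FixKind) : Computes (.fix κ t) (loopResults κ F F.ncard) where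
  finite := finite_loopResults κ hF.finite _
  p2 := by
    intro R hR
    simp only [loopResults, Set.mem_iUnion] at hR
    obtain ⟨k, -, x, hx, A, hA, ⟨hq, rfl⟩ | ⟨hq, rfl⟩⟩ := hR
    · exact p2_solveResult (sound_of_mem_loopStates hF.p2 hx) (hF.p2 A hA) hq
    · exact p2_eqResult (sound_of_mem_loopStates hF.p2 hx) (hF.p2 A hA) hq
  settles r k Q h := by
    refine .step _ ⟨_, .fixCall κ t _ k⟩ fun s' hs' => ?_
    cases hs'
    refine hF.settles_loop r k Q h ∅ (Set.empty_subset F) ?_ ?_ ?_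
    · rw [Set.ncard_empty]
      exact Set.mem_singleton _
    · simp [Cond.Holds]
    · simp

theorem exists_computes (t : MuTerm n) : ∃ F, Computes t F := by
  induction t with
  | var i => exact ⟨_, computes_var i⟩
  | zero => exact ⟨_, computes_zero⟩
  | one => exact ⟨_, computes_one⟩
  | scale q t ih =>
    obtain ⟨F, hF⟩ := ih
    exact ⟨_, hF.scale q⟩
  | bin op t₁ t₂ ih₁ ih₂ =>
    obtain ⟨F₁, h₁⟩ := ih₁
    obtain ⟨F₂, h₂⟩ := ih₂
    exact ⟨_, h₁.bin h₂ op⟩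
  | fix κ t ih =>
    obtain ⟨F, hF⟩ := ih
    exact ⟨_, hF.fix κ⟩

theorem Computes.settles_initial {t : MuTerm n} {F : Set (CLE n)} (hF : Computes t F)
    (r : Fin n → unitInterval) : Settles (fun A => A ∈ F ∧ A.P1 r) (initial t r) := by
  refine hF.settles r .halt _ fun A hA hP1 => ?_
  refine .step _ ⟨_, .finish A⟩ fun s' hs' => ?_
  cases hs'
  exact .done A ⟨hA, hP1⟩

end Computes

/-- Finitely many conditioned linear expressions with (P2), one of which is true at each input,
represent the function of the term. -/
theorem represents_of_p2 {n : ℕ} {t : MuTerm n} {F : Set (CLE n)} (hfin : F.Finite)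
    (hcov : ∀ r, ∃ A ∈ F, A.P1 r) (hP2 : ∀ A ∈ F, A.P2 t) : Represents F t.eval where
  finite := hfin
  covers := hcov
  agrees r A hA hr := by
    obtain ⟨_, he⟩ := hP2 A hA _ hr
    exact he

end LukMu

theorem mainTheorem2 {n : ℕ} (t : LukMu.MuTerm n) :
    (∀ r : Fin n → unitInterval,
      LukMu.Terminates (LukMu.initial t r) ∧
      ∀ A ∈ LukMu.outputs t r, A.P1 r ∧ A.P2 t) ∧
    LukMu.Represents (⋃ r : Fin n → unitInterval, LukMu.outputs t r) t.eval ∧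
    ∀ out : (Fin n → unitInterval) → LukMu.CLE n,
      (∀ r, out r ∈ LukMu.outputs t r) → LukMu.Represents (Set.range out) t.eval := by
  obtain ⟨F, hF⟩ := LukMu.exists_computes t
  have hset := hF.settles_initial
  have hout (r) (A) (hA : A ∈ LukMu.outputs t r) : A ∈ F ∧ A.P1 r := (hset r).of_output hA
  refine ⟨fun r => ⟨(hset r).terminates, fun A hA => ⟨(hout r A hA).2, hF.p2 A (hout r A hA).1⟩⟩,
    ?_, fun out hmem => ?_⟩
  · have hsub : (⋃ r, LukMu.outputs t r) ⊆ F := Set.iUnion_subset fun r A hA => (hout r A hA).1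
    refine LukMu.represents_of_p2 (hF.finite.subset hsub) (fun r => ?_)
      fun A hA => hF.p2 A (hsub hA)
    obtain ⟨A, hA⟩ := (hset r).exists_output
    exact ⟨A, Set.mem_iUnion.2 ⟨r, hA⟩, (hout r A hA).2⟩
  · have hsub : Set.range out ⊆ F := by
      rintro _ ⟨r, rfl⟩
      exact (hout r _ (hmem r)).1
    exact LukMu.represents_of_p2 (hF.finite.subset hsub)
      (fun r => ⟨out r, Set.mem_range_self r, (hout r _ (hmem r)).2⟩)
      fun A hA => hF.p2 A (hsub hA)
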